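/- Let $K$ be a field. A weighted oriented graph $D$ consists of an orientation of a finite simple graph (so for each edge $\{u,v\}$ exactly one of $(u,v)$, $(v,u)$ lies in $E(D)$) together with a weight function $w$ from its vertex set $V(D)$ to the positive integers. Its edge ideal is $I(D)=\langle x_u x_v^{w(v)} : (u,v)\in E(D)\rangle \subseteq K[x_v : v\in V(D)]$, and $D$ is called Cohen–Macaulay (over $K$) if the ring $K[x_v : v\in V(D)]/I(D)$ is Cohen–Macaulay. For $S\subseteq V(D)$, let $D\setminus S$ be the weighted oriented graph obtained by deleting the vertices in $S$ and all edges meeting $S$, keeping the remaining directions and weights. Let $D_H$ be a weighted oriented graph and $z$ a vertex of $D_H$. Let $x_1,\dots,x_k$ be all the vertices of $D_H$ adjacent to $z$, and suppose that every edge at $z$ is directed towards $z$, i.e. $(x_i,z)\in E(D_H)$ for $i=1,\dots,k$. If $D_H$ is Cohen–Macaulay, then $D_F=D_H\setminus\{z,x_1,\dots,x_k\}$ is Cohen–Macaulay. -/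

import Mathlib

/-! ### Cohen–Macaulay rings -/

/-- The depth of a local ring: the supremum of the lengths of the regular sequences
contained in the maximal ideal. -/
noncomputable def localRingDepth (R : Type*) [CommRing R] [IsLocalRing R] : ℕ∞ :=
  ⨆ (rs : List R)
    (_ : (∀ r ∈ rs, r ∈ IsLocalRing.maximalIdeal R) ∧ RingTheory.Sequence.IsRegular R rs),
    (rs.length : ℕ∞)

/-- A Cohen–Macaulay local ring: a Noetherian local ring whose depth is its Krull dimension. -/
structure IsCohenMacaulayLocalRing (R : Type*) [CommRing R] [IsLocalRing R] : Prop where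
  isNoetherianRing : IsNoetherianRing R
  depth_eq : (localRingDepth R : WithBot ℕ∞) = ringKrullDim R

/-- A Cohen–Macaulay ring: a Noetherian ring all of whose localizations at primes are
Cohen–Macaulay local rings. -/
structure IsCohenMacaulayRing (R : Type*) [CommRing R] : Prop where
  isNoetherianRing : IsNoetherianRing R
  localization : ∀ (p : Ideal R) [p.IsPrime],
    IsCohenMacaulayLocalRing (Localization.AtPrime p)

/-! ### Weighted oriented graphs -/

/-- A weighted oriented graph on the vertex set `V`: an orientation of a simple graph (at most one
of `(u, v)`, `(v, u)` is an edge and there are no loops) with positive integer vertex weights.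
`D.Edge u v` says that there is an edge directed from `u` to `v`. -/
structure WeightedOrientedGraph (V : Type*) where
  Edge : V → V → Prop
  asymm : ∀ u v, Edge u v → ¬ Edge v u
  weight : V → ℕ
  weight_pos : ∀ v, 0 < weight v

namespace WeightedOrientedGraph

variable {V : Type*}

/-- The underlying simple graph. -/
def underlying (D : WeightedOrientedGraph V) : SimpleGraph V where
  Adj u v := D.Edge u v ∨ D.Edge v u
  symm := ⟨fun _ _ h => h.symm⟩
  loopless := ⟨fun v h => h.elim (fun e => D.asymm v v e e) (fun e => D.asymm v v e e)⟩

/-- `D ∖ S`: the vertices of `S`, and all edges meeting `S`, are removed; directions of the other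
edges and weights of the other vertices are kept. -/
def deleteVerts (D : WeightedOrientedGraph V) (S : Set V) :
    WeightedOrientedGraph {v : V // v ∉ S} where
  Edge u v := D.Edge u v
  asymm u v := D.asymm u v
  weight v := D.weight v
  weight_pos v := D.weight_pos v

/-- The edge ideal, generated by the monomials `x_u * x_v ^ w(v)` for the edges `(u, v)`, in the
polynomial ring over `K` with one variable for each vertex. -/
noncomputable def edgeIdeal (D : WeightedOrientedGraph V) (K : Type*) [Field K] :
    Ideal (MvPolynomial V K) :=
  Ideal.span {f | ∃ u v, D.Edge u v ∧
    f = MvPolynomial.X u * MvPolynomial.X v ^ D.weight v}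

/-- `D` is Cohen–Macaulay over `K` if the quotient of the polynomial ring by the edge ideal is a
Cohen–Macaulay ring. -/
def IsCohenMacaulay (D : WeightedOrientedGraph V) (K : Type*) [Field K] : Prop :=
  IsCohenMacaulayRing (MvPolynomial V K ⧸ D.edgeIdeal K)

end WeightedOrientedGraph

/-! Modulo `X z - 1`, each generator `x_i * z ^ w(z)` becomes `x_i`, so the neighbors of `z` vanish
and the edge ideal of `D ∖ N[z]` remains: its coordinate ring is that of `D` modulo one element.
That element is a nonzerodivisor because the edge ideal is monomial, and Cohen–Macaulayness descends
modulo a nonzerodivisor. The descent is checked at each prime of the quotient, where the dimension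
drops by exactly one and the depth by at most one. -/

open CategoryTheory Abelian in
/-- Modulo a regular element of the maximal ideal, the depth of a Noetherian local ring drops by at
most one. -/
lemma IsLocalRing.exists_isRegular_quotSMulTop {R : Type*} [CommRing R] [IsLocalRing R]
    [IsNoetherianRing R] {a : R} (ha : a ∈ maximalIdeal R) (reg : IsSMulRegular R a) {n : ℕ}
    (h : ∃ rs : List R, rs.length = n + 1 ∧ (∀ r ∈ rs, r ∈ maximalIdeal R) ∧
      RingTheory.Sequence.IsRegular R rs) :
    ∃ rs : List R, rs.length = n ∧ (∀ r ∈ rs, r ∈ maximalIdeal R) ∧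
      RingTheory.Sequence.IsRegular (QuotSMulTop a R) rs := by
  have lt_top (M : ModuleCat R) [Nontrivial M] [Module.Finite R M] :
      maximalIdeal R • (⊤ : Submodule R M) < ⊤ :=
    (Submodule.top_ne_ideal_smul_of_le_jacobson_annihilator
      (maximalIdeal_le_jacobson _)).symm.lt_top
  have : Nontrivial (QuotSMulTop a R) := nontrivial_quotSMulTop_of_mem_maximalIdeal R ha
  have ext_self := ((ModuleCat.exists_isRegular_tfae (maximalIdeal R) (n + 1) (ModuleCat.of R R)
    (lt_top _)).out 3 1).mp h
  refine ((ModuleCat.exists_isRegular_tfae (maximalIdeal R) n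
    (ModuleCat.of R (QuotSMulTop a R)) (lt_top _)).out 1 3).mp fun i hi ↦ ?_
  -- In the long exact sequence of `0 → R → R → R/aR → 0`, the `i`-th `Ext` into `R/aR` lies between
  -- the `i`-th and `(i + 1)`-st into `R`. Both vanish since `i + 1 < n + 1`.
  have zero₁ := AddCommGrpCat.isZero_of_iff_subsingleton.mpr (ext_self i (by omega))
  have zero₂ := AddCommGrpCat.isZero_of_iff_subsingleton.mpr (ext_self (i + 1) (by omega))
  exact AddCommGrpCat.subsingleton_of_isZero <| ShortComplex.Exact.isZero_of_both_zeros
    ((Ext.covariant_sequence_exact₃' _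
      (IsSMulRegular.smulShortComplex_shortExact (M := ModuleCat.of R R) reg)) i (i + 1) rfl)
    (zero₁.eq_zero_of_src _) (zero₂.eq_zero_of_tgt _)

lemma localRingDepth_le_ringKrullDim (R : Type*) [CommRing R] [IsLocalRing R]
    [IsNoetherianRing R] : (localRingDepth R : WithBot ℕ∞) ≤ ringKrullDim R := by
  obtain ⟨d, hd⟩ : ∃ d : ℕ∞, ringKrullDim R = d :=
    ⟨_, (WithBot.coe_unbot _ ringKrullDim_ne_bot).symm⟩
  rw [hd, WithBot.coe_le_coe]
  refine iSup₂_le fun rs hrs ↦ ?_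
  rw [← WithBot.coe_le_coe, ← hd,
    ← ringKrullDim_add_length_eq_ringKrullDim_of_isRegular rs hrs.2]
  have : Nontrivial (R ⧸ Ideal.ofList rs) :=
    Ideal.Quotient.nontrivial_iff.mpr fun h ↦ hrs.2.2 (by simp [h])
  exact le_add_of_nonneg_left ringKrullDim_nonneg_of_nontrivial

lemma IsCohenMacaulayLocalRing.of_surjective_of_ker_eq_span_singleton {R S : Type*} [CommRing R]
    [IsLocalRing R] [CommRing S] [IsLocalRing S] (hR : IsCohenMacaulayLocalRing R) (f : R →+* S)
    (hf : Function.Surjective f) {a : R} (reg : IsSMulRegular R a)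
    (hker : RingHom.ker f = Ideal.span {a}) : IsCohenMacaulayLocalRing S := by
  have := hR.isNoetherianRing
  have : IsNoetherianRing S := isNoetherianRing_of_surjective R S f hf
  refine ⟨this, (localRingDepth_le_ringKrullDim S).antisymm ?_⟩
  have ha : a ∈ IsLocalRing.maximalIdeal R := by
    refine IsLocalRing.le_maximalIdeal (RingHom.ker_ne_top f) ?_
    exact hker ▸ Ideal.mem_span_singleton_self a
  have hdim : ringKrullDim S + 1 = ringKrullDim R := by
    rw [← ringKrullDim_quotient_span_singleton_succ_eq_ringKrullDim reg ha, ← hker,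
      ringKrullDim_eq_of_ringEquiv (RingHom.quotientKerEquivOfSurjective hf)]
  obtain ⟨n, hn⟩ : ∃ n : ℕ, ringKrullDim S = n := by
    obtain ⟨d, hd⟩ : ∃ d : ℕ∞, ringKrullDim S = d :=
      ⟨_, (WithBot.coe_unbot _ ringKrullDim_ne_bot).symm⟩
    have hd_ne : d ≠ ⊤ := fun h ↦ ringKrullDim_ne_top (hd.trans (by rw [h]; rfl))
    obtain ⟨n, rfl⟩ := ENat.ne_top_iff_exists.mp hd_ne
    exact ⟨n, hd⟩
  have hdepth : localRingDepth R = (n + 1 : ℕ) := by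
    rw [← WithBot.coe_inj, hR.depth_eq, ← hdim, hn]; rfl
  have hex : ∃ rs : List R, rs.length = n + 1 ∧ (∀ r ∈ rs, r ∈ IsLocalRing.maximalIdeal R) ∧
      RingTheory.Sequence.IsRegular R rs := by
    -- The supremum `n + 1` is attained: some regular sequence is longer than `n`, and none is
    -- longer than `n + 1`.
    have hlt : (n : ℕ∞) < localRingDepth R := by rw [hdepth]; exact_mod_cast n.lt_succ_self
    obtain ⟨rs, h⟩ := lt_iSup_iff.mp hlt
    obtain ⟨hrs, h⟩ := lt_iSup_iff.mp h
    refine ⟨rs, le_antisymm ?_ (by exact_mod_cast h), hrs⟩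
    have hle : (rs.length : ℕ∞) ≤ localRingDepth R := le_iSup₂_of_le rs hrs le_rfl
    rw [hdepth] at hle
    exact_mod_cast hle
  obtain ⟨rs, hlen, hmem, hrs⟩ := IsLocalRing.exists_isRegular_quotSMulTop ha reg hex
  let := f.toAlgebra
  let e : QuotSMulTop a R ≃ₗ[R] S :=
    (Submodule.quotEquivOfEq _ _ (by
      rw [← Submodule.ideal_span_singleton_smul, ← hker]
      ext x; simp [RingHom.algebraMap_toAlgebra])).trans
      (LinearMap.quotKerEquivOfSurjective (Algebra.linearMap R S) hf)
  have hmem' : ∀ r ∈ rs.map f, r ∈ IsLocalRing.maximalIdeal S := by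
    have := IsLocalHom.of_surjective f hf
    intro r hr
    obtain ⟨s, hs, rfl⟩ := List.mem_map.mp hr
    exact IsLocalRing.map_maximalIdeal_le f (Ideal.mem_map_of_mem f (hmem s hs))
  have hreg : RingTheory.Sequence.IsRegular S (rs.map f) :=
    .of_isWeaklyRegular_of_mem_maximalIdeal S hmem' <|
      (RingTheory.Sequence.isWeaklyRegular_map_algebraMap_iff S S rs).mpr <|
        (e.isWeaklyRegular_congr rs).mp hrs.toIsWeaklyRegular
  rw [hn]
  change ((n : ℕ∞) : WithBot ℕ∞) ≤ _
  rw [WithBot.coe_le_coe]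
  refine le_iSup₂_of_le (rs.map f) ⟨hmem', hreg⟩ ?_
  simp [hlen]

lemma IsCohenMacaulayRing.of_surjective_of_ker_eq_span_singleton {R S : Type*} [CommRing R]
    [CommRing S] (hR : IsCohenMacaulayRing R) (f : R →+* S)
    (hf : Function.Surjective f) {a : R} (reg : IsSMulRegular R a)
    (hker : RingHom.ker f = Ideal.span {a}) : IsCohenMacaulayRing S := by
  have := hR.isNoetherianRing
  refine ⟨isNoetherianRing_of_surjective R S f hf, fun q _ ↦ ?_⟩
  let p := q.comap f
  let g : Localization.AtPrime p →+* Localization.AtPrime q := Localization.localRingHom p q f rfl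
  have hg (x : R) (s : p.primeCompl) :
      g (IsLocalization.mk' _ x s) = IsLocalization.mk' _ (f x) (⟨f s, s.2⟩ : q.primeCompl) :=
    Localization.localRingHom_mk' p q f rfl x s
  refine (hR.localization p).of_surjective_of_ker_eq_span_singleton g ?_
    (a := algebraMap R _ a) ?_ ?_
  · intro y
    obtain ⟨b, ⟨t, ht⟩, rfl⟩ := IsLocalization.exists_mk'_eq q.primeCompl y
    obtain ⟨b, rfl⟩ := hf b
    obtain ⟨t, rfl⟩ := hf t
    exact ⟨IsLocalization.mk' _ b (⟨t, ht⟩ : p.primeCompl), hg _ _⟩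
  · exact (RingTheory.Sequence.isWeaklyRegular_singleton_iff _ _).mp <|
      ((RingTheory.Sequence.isWeaklyRegular_singleton_iff R a).mpr reg).of_isLocalization
        (Localization.AtPrime p) p.primeCompl
  · refine le_antisymm (fun y hy ↦ ?_) ?_
    · obtain ⟨x, s, rfl⟩ := IsLocalization.exists_mk'_eq p.primeCompl y
      rw [RingHom.mem_ker, hg, IsLocalization.mk'_eq_zero_iff] at hy
      obtain ⟨⟨t, ht⟩, h⟩ := hy
      obtain ⟨t, rfl⟩ := hf t
      -- If `t` kills `f x`, then `t * x = a * c`, so `x / s = a * (c / (t * s))`.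
      obtain ⟨c, hc⟩ : a ∣ t * x := by
        rw [← Ideal.mem_span_singleton, ← hker, RingHom.mem_ker, map_mul]
        exact h
      rw [Ideal.mem_span_singleton]
      refine ⟨IsLocalization.mk' _ c ((⟨t, ht⟩ : p.primeCompl) * s), ?_⟩
      rw [IsLocalization.mul_mk'_eq_mk'_of_mul, ← hc, IsLocalization.mk'_eq_iff_eq]
      simp only [Submonoid.coe_mul]
      ring_nf
    · rw [Ideal.span_singleton_le_iff_mem, RingHom.mem_ker, Localization.localRingHom_to_map]
      have : f a = 0 := by
        rw [← RingHom.mem_ker, hker]; exact Ideal.mem_span_singleton_self a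
      rw [this, map_zero]

-- The coefficient of `(X i - 1) * f` at `m` is that of `f` at `m - e_i` (zero if `m i = 0`) minus
-- that at `m`. If it vanishes for some `m` in the support of `f`, then `m - e_i` is also in the
-- support. Descent on the exponent of `i` yields a generator dividing a smaller monomial, hence
-- dividing `m`.
open MvPolynomial in
lemma MvPolynomial.isSMulRegular_quotient_span_monomial_image_X_sub_one {σ R : Type*} [CommRing R]
    (s : Set (σ →₀ ℕ)) (i : σ) :
    IsSMulRegular (MvPolynomial σ R ⧸ Ideal.span ((fun m ↦ monomial m (1 : R)) '' s))
      (X i - 1 : MvPolynomial σ R) := by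
  classical
  rw [isSMulRegular_quotient_iff_mem_of_smul_mem]
  intro f hf
  rw [smul_eq_mul, mem_ideal_span_monomial_image] at hf
  rw [mem_ideal_span_monomial_image]
  suffices ∀ n, ∀ m ∈ f.support, m i = n → ∃ t ∈ s, t ≤ m from fun m hm ↦ this _ m hm rfl
  intro n
  induction n using Nat.strong_induction_on with
  | _ n ih =>
    rintro m hm rfl
    by_cases hm' : m ∈ ((X i - 1) * f).support
    · exact hf m hm'
    · rw [notMem_support_iff, sub_mul, one_mul, coeff_sub, coeff_X_mul', sub_eq_zero] at hm'
      rw [mem_support_iff, ← hm'] at hm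
      split_ifs at hm with hi
      · obtain ⟨t, ht, hle⟩ := ih ((m - Finsupp.single i 1 : σ →₀ ℕ) i)
          (by simpa [Nat.pos_iff_ne_zero] using hi) _ (mem_support_iff.mpr hm) rfl
        exact ⟨t, ht, hle.trans tsub_le_self⟩
      · exact (hm rfl).elim

namespace WeightedOrientedGraph

open MvPolynomial

variable {V : Type*} (D : WeightedOrientedGraph V) (K : Type*) [Field K]

lemma edgeIdeal_eq_span_monomial_image :
    D.edgeIdeal K = Ideal.span ((fun m ↦ monomial m (1 : K)) ''
      {m | ∃ u v, D.Edge u v ∧ m = Finsupp.single u 1 + Finsupp.single v (D.weight v)}) := by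
  rw [edgeIdeal]
  congr 1
  have key (u v : V) : (X u * X v ^ D.weight v : MvPolynomial V K) =
      monomial (Finsupp.single u 1 + Finsupp.single v (D.weight v)) 1 := by
    rw [X_pow_eq_monomial, X, monomial_mul, one_mul]
  ext f
  constructor
  · rintro ⟨u, v, h, rfl⟩
    exact ⟨_, ⟨u, v, h, rfl⟩, (key u v).symm⟩
  · rintro ⟨_, ⟨u, v, h, rfl⟩, rfl⟩
    exact ⟨u, v, h, (key u v).symm⟩

lemma isSMulRegular_mk_X_sub_one (z : V) :
    IsSMulRegular (MvPolynomial V K ⧸ D.edgeIdeal K)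
      (Ideal.Quotient.mk (D.edgeIdeal K) (X z - 1)) := by
  have h : IsSMulRegular (MvPolynomial V K ⧸ D.edgeIdeal K) (X z - 1 : MvPolynomial V K) := by
    rw [edgeIdeal_eq_span_monomial_image]
    exact isSMulRegular_quotient_span_monomial_image_X_sub_one _ z
  exact h

variable {D}

lemma X_mul_X_pow_mem_edgeIdeal {u v : V} (h : D.Edge u v) :
    (X u * X v ^ D.weight v : MvPolynomial V K) ∈ D.edgeIdeal K :=
  Ideal.subset_span ⟨u, v, h, rfl⟩

open Classical in
/-- If all edges at `z` are directed towards `z`, then setting `z` to one and the neighbors of `z`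
to zero maps the edge ideal of `D` into that of `D ∖ N[z]`. -/
theorem exists_surjective_ker_eq_span_X_sub_one {z : V}
    (hz : ∀ x ∈ D.underlying.neighborSet z, D.Edge x z) :
    ∃ f : MvPolynomial V K ⧸ D.edgeIdeal K →+*
        MvPolynomial {v : V // v ∉ insert z (D.underlying.neighborSet z)} K ⧸
          (D.deleteVerts (insert z (D.underlying.neighborSet z))).edgeIdeal K,
      Function.Surjective f ∧
        RingHom.ker f = Ideal.span {Ideal.Quotient.mk (D.edgeIdeal K) (X z - 1)} := by
  set N := D.underlying.neighborSet z
  set D' := D.deleteVerts (insert z N)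
  have hzN : z ∉ N := fun h ↦ D.underlying.loopless.irrefl z h
  let val (v : V) : MvPolynomial {v : V // v ∉ insert z N} K :=
    if h : v ∈ insert z N then (if v = z then 1 else 0) else X ⟨v, h⟩
  have val_self : val z = 1 := by simp [val]
  have val_nbr {v : V} (h : v ∈ N) : val v = 0 := by
    have : v ≠ z := fun e ↦ hzN (e ▸ h)
    simp [val, h, this]
  have val_rest {v : V} (h : v ∉ insert z N) : val v = X ⟨v, h⟩ := by simp only [val, dif_neg h]
  let F : MvPolynomial V K ⧸ D.edgeIdeal K →ₐ[K] MvPolynomial _ K ⧸ D'.edgeIdeal K :=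
    Ideal.Quotient.liftₐ _ ((Ideal.Quotient.mkₐ K _).comp (aeval val)) (by
      suffices D.edgeIdeal K ≤ (D'.edgeIdeal K).comap (aeval val) from
        fun x hx ↦ Ideal.Quotient.eq_zero_iff_mem.mpr (this hx)
      refine Ideal.span_le.mpr ?_
      rintro _ ⟨u, v, huv, rfl⟩
      rw [SetLike.mem_coe, Ideal.mem_comap, map_mul, map_pow, aeval_X, aeval_X]
      by_cases hu : u ∈ insert z N
      · obtain rfl | hu := hu
        · exact (D.asymm _ _ huv (hz v (Or.inl huv))).elim
        · simp [val_nbr hu]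
      by_cases hv : v ∈ insert z N
      · obtain rfl | hv := hv
        · exact (hu (Or.inr (Or.inr huv))).elim
        -- A weight of zero would give `0 ^ 0 = 1` here.
        · simp [val_nbr hv, (D.weight_pos v).ne']
      rw [val_rest hu, val_rest hv]
      exact X_mul_X_pow_mem_edgeIdeal (D := D') K (u := ⟨u, hu⟩) (v := ⟨v, hv⟩) huv)
  have F_X (v : V) : F (Ideal.Quotient.mk _ (X v)) = Ideal.Quotient.mk _ (val v) := by
    change Ideal.Quotient.mk _ (aeval val (X v)) = _
    rw [aeval_X]
  let J : Ideal (MvPolynomial V K) := D.edgeIdeal K ⊔ Ideal.span {X z - 1}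
  let π : MvPolynomial V K →ₐ[K] MvPolynomial V K ⧸ J := Ideal.Quotient.mkₐ K J
  have π_gen {u v : V} (h : D.Edge u v) : π (X u) * π (X v) ^ D.weight v = 0 := by
    rw [← map_pow, ← map_mul]
    exact Ideal.Quotient.eq_zero_iff_mem.mpr
      (Ideal.mem_sup_left (X_mul_X_pow_mem_edgeIdeal K h))
  have π_self : π (X z) = 1 := by
    rw [← sub_eq_zero, ← map_one π, ← map_sub]
    exact Ideal.Quotient.eq_zero_iff_mem.mpr 
      (Ideal.mem_sup_right (Ideal.mem_span_singleton_self _))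
  -- The edge from `v` to `z` gives the relation `X v * 1 ^ w(z) = 0`.
  have π_nbr {v : V} (h : v ∈ N) : π (X v) = 0 := by
    simpa [π_self] using π_gen (hz v h)
  let G : MvPolynomial _ K ⧸ D'.edgeIdeal K →ₐ[K] MvPolynomial V K ⧸ J :=
    Ideal.Quotient.liftₐ _ (aeval fun v ↦ π (X v.1)) (by
      suffices D'.edgeIdeal K ≤ RingHom.ker (aeval fun v : {v // v ∉ insert z N} ↦ π (X v.1)) from
        fun x hx ↦ this hx
      refine Ideal.span_le.mpr ?_
      rintro _ ⟨u, v, huv, rfl⟩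
      rw [SetLike.mem_coe, RingHom.mem_ker, map_mul, map_pow, aeval_X, aeval_X]
      exact π_gen huv)
  -- Since `G ∘ F` is the projection modulo `X z - 1`, anything killed by `F` is a multiple of `X z
  -- - 1`.
  have GF : (G.comp F).comp (Ideal.Quotient.mkₐ K _) = π := by
    refine MvPolynomial.algHom_ext fun v ↦ ?_
    change G (F (Ideal.Quotient.mk _ (X v))) = _
    rw [F_X]
    change aeval (fun v ↦ π (X v.1)) (val v) = _
    by_cases hv : v ∈ insert z N
    · obtain rfl | hv := hv
      · rw [val_self, map_one, π_self]
      · rw [val_nbr hv, map_zero, π_nbr hv]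
    · rw [val_rest hv, aeval_X]
  refine ⟨F.toRingHom, fun y ↦ ?_, le_antisymm (fun x hx ↦ ?_) ?_⟩
  · obtain ⟨y, rfl⟩ := Ideal.Quotient.mk_surjective y
    refine ⟨Ideal.Quotient.mk _ (rename Subtype.val y), ?_⟩
    change Ideal.Quotient.mk _ (aeval val (rename Subtype.val y)) = _
    rw [aeval_rename]
    have : val ∘ Subtype.val = X := funext fun v ↦ val_rest v.2
    rw [this, aeval_X_left_apply]
  · obtain ⟨x, rfl⟩ := Ideal.Quotient.mk_surjective x
    have hx : F (Ideal.Quotient.mk _ x) = 0 := hx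
    have h : G (F (Ideal.Quotient.mk _ x)) = π x := DFunLike.congr_fun GF x
    rw [hx, map_zero] at h
    have hJ := Ideal.mem_map_of_mem (Ideal.Quotient.mk (D.edgeIdeal K))
      (Ideal.Quotient.eq_zero_iff_mem.mp h.symm)
    rwa [Ideal.map_sup, Ideal.map_quotient_self, bot_sup_eq, Ideal.map_span,
      Set.image_singleton] at hJ
  · rw [Ideal.span_singleton_le_iff_mem, RingHom.mem_ker]
    change F _ = 0
    rw [map_sub, map_sub, F_X, val_self, map_one, map_one, map_one, sub_self]

end WeightedOrientedGraph

theorem proposition3p7 {K : Type*} [Field K] {V : Type*} [Finite V]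
    (D : WeightedOrientedGraph V) (z : V)
    (hz : ∀ x ∈ D.underlying.neighborSet z, D.Edge x z)
    (hD : D.IsCohenMacaulay K) :
    (D.deleteVerts (insert z (D.underlying.neighborSet z))).IsCohenMacaulay K := by
  obtain ⟨f, hf, hker⟩ := WeightedOrientedGraph.exists_surjective_ker_eq_span_X_sub_one K hz
  exact IsCohenMacaulayRing.of_surjective_of_ker_eq_span_singleton hD f hf
    (D.isSMulRegular_mk_X_sub_one K z) hker
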